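/- **Theorem 3.2 (Medini forcing $\mathbb M_{A,B}$).** Subsets of $\omega$ are identified with their characteristic functions in $2^\omega$; $Y\subseteq^* Z$ means that $Y\setminus Z$ is finite; $[x(n)=1]=\{x\in 2^\omega : x(n)=1\}$; a subset of $2^\omega$ is $\aleph_1$-dense if it meets every nonempty open set in exactly $\aleph_1$ points. Let $\mathcal T$ be a tower (a family of infinite subsets of $\omega$, reverse well ordered by $\subseteq^*$, where members may be equal modulo finite sets) of size $\aleph_1$ which is $\aleph_1$-dense in $2^\omega$ and has an infinite, co-infinite top element $X\in\mathcal T$ (so $Y\subseteq^* X$ for all $Y\in\mathcal T$). Let $A=\{\omega\setminus Y : Y\in\mathcal T\}$, and let $B\subseteq 2^\omega$ be any $\aleph_1$-dense set all of whose elements are infinite and have finite intersection with $X$. Let $A=\bigcup_{\alpha<\omega_1}A_\alpha$ and $B=\bigcup_{\alpha<\omega_1}B_\alpha$ be partitions into countable dense subsets of $2^\omega$. Let $\mathbb M_{A,B}$ be the set of pairs $p=(\pi_p,f_p)$ such that $f_p$ is a finite partial injection from $A$ to $B$ with $a\in A_\alpha\iff f_p(a)\in B_\alpha$ for all $a\in\operatorname{dom}(f_p)$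 and $\alpha<\omega_1$, and $\pi_p$ is a permutation of $2^{n_p}$ for some $n_p\in\omega$ with $f_p(a)\restriction n_p=\pi_p(a\restriction n_p)$ for all $a\in\operatorname{dom}(f_p)$. Put $p\le q$ iff $f_p\supseteq f_q$, $n_p\ge n_q$, and $\pi_p(t)\restriction n_q=\pi_q(t\restriction n_q)$ for all $t\in 2^{n_p}$. Then $\mathbb M_{A,B}$ is $\sigma$-centered. It forces that the formula $h(x)\restriction n_p=\pi_p(x\restriction n_p)$ (for all $x\in 2^\omega$ and all $p$ in the generic filter) defines a function $h:2^\omega\to2^\omega$ in the generic extension, and that $h$ is a homeomorphism which extends $f_p$ for every $p$ in the generic filter and satisfies $h``A=B$ and $h``[x(n)=1]=[x(n)=1]$ for infinitely many $n\in X$. In particular, $\mathbb M_{A,B}$ adds a pseudointersection to $\mathcal T$: it forces that there is an infinite $Y\subseteq\omega$ with $Y\subseteq^* Z$ for all $Z\in\mathcal T$. -/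

import Mathlib

open scoped Cardinal

/-!  ## The Cantor space, towers, `ℵ₁`-dense sets

The set `ω` is `ℕ`.  Subsets of `ω` are identified with their characteristic functions, which are
points of the Cantor space `2^ω`, here `ℕ → Bool` with the product topology. -/

/-- The Cantor space `2^ω`. -/
abbrev Cantor : Type := ℕ → Bool

open Classical in
/-- The characteristic function of a subset of `ω`. -/
noncomputable def charFn (Y : Set ℕ) : Cantor := fun n => decide (n ∈ Y)

/-- The subset of `ω` whose characteristic function is `x`. -/
def supp (x : Cantor) : Set ℕ := {n | x n = true}

/-- `Y ⊆^* Z`: all but finitely many elements of `Y` lie in `Z`. -/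
def AlmostSubset (Y Z : Set ℕ) : Prop := (Y \ Z).Finite

/-- A tower: a set of infinite subsets of `ω` which is reverse well ordered by `⊆^*`, that is, every
nonempty subset of it has a `⊆^*`-largest element.  (As usual for `⊆^*`, which is only a preorder,
different members may be equal modulo a finite set.) -/
structure IsTower (T : Set (Set ℕ)) : Prop where
  infinite : ∀ Y ∈ T, Y.Infinite
  wellOrdered : ∀ S ⊆ T, S.Nonempty → ∃ Y ∈ S, ∀ Z ∈ S, AlmostSubset Z Y

/-- A subset of `2^ω` is `ℵ₁`-dense if it meets every nonempty open set in exactly `ℵ₁` points. -/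
def AlephOneDense (S : Set Cantor) : Prop :=
  ∀ U : Set Cantor, IsOpen U → U.Nonempty → #(S ∩ U : Set Cantor) = ℵ₁

/-- `part` is a partition of `S` into countable dense subsets of `2^ω`. -/
structure IsCountableDensePartition {I : Type} (S : Set Cantor) (part : I → Set Cantor) : Prop where
  iUnion_eq : ⋃ α, part α = S
  disjoint : ∀ α β, α ≠ β → Disjoint (part α) (part β)
  countable : ∀ α, (part α).Countable
  dense : ∀ α, Dense (part α)

/-! ## Medini's forcing notion -/

/-- The restriction `x ↾ n` of a point of `2^ω`. -/
def restr (n : ℕ) (x : Cantor) : Fin n → Bool := fun i => x i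

/-- The restriction `t ↾ n` of a finite sequence of length `m ≥ n`. -/
def restrFin {n m : ℕ} (h : n ≤ m) (t : Fin m → Bool) : Fin n → Bool := fun i => t (Fin.castLE h i)

/-- The conditions `(π, f)` of Medini's forcing notion `𝕄_{A,B}` for the partitions `A = ⋃ A_α` and
`B = ⋃ B_α`; the finite partial injection `f` is given by its graph. -/
structure Medini {I : Type} (A B : Set Cantor) (Apart Bpart : I → Set Cantor) : Type where
  /-- the graph of `f` -/
  graph : Finset (Cantor × Cantor)
  /-- the length `n` -/
  len : ℕ
  /-- the permutation of `2^n` -/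
  perm : Equiv.Perm (Fin len → Bool)
  maps : ∀ z ∈ graph, z.1 ∈ A ∧ z.2 ∈ B
  functional : ∀ z ∈ graph, ∀ w ∈ graph, z.1 = w.1 → z.2 = w.2
  injective : ∀ z ∈ graph, ∀ w ∈ graph, z.2 = w.2 → z.1 = w.1
  levels : ∀ z ∈ graph, ∀ α, z.1 ∈ Apart α ↔ z.2 ∈ Bpart α
  respects : ∀ z ∈ graph, restr len z.2 = perm (restr len z.1)

namespace Medini

variable {I : Type} {A B : Set Cantor} {Apart Bpart : I → Set Cantor}

/-- `p ≤ q` (that is, `p` is stronger than `q`) if `f_p ⊇ f_q` and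
`π_p(t) ↾ n_q = π_q(t ↾ n_q)` for all `t` in `2^{n_p}`. -/
instance : Preorder (Medini A B Apart Bpart) where
  le p q := q.graph ⊆ p.graph ∧
    ∃ h : q.len ≤ p.len, ∀ t : Fin p.len → Bool,
      restrFin h (p.perm t) = q.perm (restrFin h t)
  le_refl p := ⟨fun _ h => h, le_rfl, fun _ => rfl⟩
  le_trans p q r := by
    rintro ⟨h1, l1, e1⟩ ⟨h2, l2, e2⟩
    refine ⟨fun z hz => h1 (h2 hz), l2.trans l1, fun t => ?_⟩
    have a := e2 (restrFin l1 t)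
    rw [← e1 t] at a
    exact a

/-- The weakest condition: `f` is empty and `n = 0`. -/
instance : OrderTop (Medini A B Apart Bpart) where
  top :=
    { graph := ∅
      len := 0
      perm := Equiv.refl _
      maps := by simp
      functional := by simp
      injective := by simp
      levels := by simp
      respects := by simp }
  le_top p := ⟨Finset.empty_subset _, Nat.zero_le _, fun _ => funext fun i => i.elim0⟩

end Medini

/-- A forcing notion is `σ`-centered if it is a countable union of centered sets, that is, of sets
all of whose finite subsets have a common extension. -/
def SigmaCentered (P : Type) [Preorder P] : Prop :=
  ∃ C : ℕ → Set P, (∀ p, ∃ n, p ∈ C n) ∧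
    ∀ n, ∀ F : Finset P, (∀ p ∈ F, p ∈ C n) → ∃ q, ∀ p ∈ F, q ≤ p

/-! ## Forcing: names and the forcing relation -/

/-- `P`-names: a name is a set of pairs `(σ, p)` of a name `σ` and a condition `p`. -/
inductive PName (P : Type) : Type 1 where
  | mk (ι : Type) (elt : ι → PName P) (cnd : ι → P) : PName P

/-- A statement of the forcing language, given by the conditions that force it: `φ p` is `p ⊩ φ`.
The statements are built from `σ = τ` and `σ ∈ τ` for names by the clauses of the
definition of the forcing relation given below. -/
abbrev Stmt (P : Type) : Type := P → Prop

namespace Forcing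

section Relation

variable {P : Type} [Preorder P]

/-- `p ⊩ σ = τ`: for each `(σ', s) ∈ σ`, it is dense below every common extension of `p` and `s` to
force `σ' = τ'` for some `(τ', t) ∈ τ` while extending `t`; and symmetrically. -/
def eq : PName P → PName P → Stmt P
  | ⟨ι, a, s⟩, ⟨κ, b, t⟩ => fun p =>
    (∀ i : ι, ∀ q ≤ p, q ≤ s i → ∃ r ≤ q, ∃ j : κ, r ≤ t j ∧ eq (a i) (b j) r) ∧
    (∀ j : κ, ∀ q ≤ p, q ≤ t j → ∃ r ≤ q, ∃ i : ι, r ≤ s i ∧ eq (a i) (b j) r)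

/-- `p ⊩ σ ∈ τ`: it is dense below `p` to force `σ = τ'` for some `(τ', t) ∈ τ` while
extending `t`. -/
def mem (x : PName P) : PName P → Stmt P
  | ⟨κ, b, t⟩ => fun p => ∀ q ≤ p, ∃ r ≤ q, ∃ j : κ, r ≤ t j ∧ eq x (b j) r

/-- A statement about the ground model that is absolute. -/
def ground (a : Prop) : Stmt P := fun _ => a

/-- `p ⊩ φ ∧ ψ`. -/
def and (φ ψ : Stmt P) : Stmt P := fun p => φ p ∧ ψ p

/-- `p ⊩ φ → ψ`. -/
def imp (φ ψ : Stmt P) : Stmt P := fun p => ∀ q ≤ p, φ q → ψ q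

/-- `p ⊩ φ ↔ ψ`. -/
def iff (φ ψ : Stmt P) : Stmt P := and (imp φ ψ) (imp ψ φ)

/-- `p ⊩ ∀ x, φ x`, where `x` ranges over all names, or over the elements of a ground model set. -/
def all {α : Sort*} (φ : α → Stmt P) : Stmt P := fun p => ∀ x, φ x p

/-- `p ⊩ ∃ x, φ x`, where `x` ranges over all names, or over the elements of a ground model set. -/
def ex {α : Sort*} (φ : α → Stmt P) : Stmt P := fun p => ∀ q ≤ p, ∃ r ≤ q, ∃ x, φ x r

/-- `p ⊩ c ∈ Ġ` for the canonical name `Ġ` of the generic filter: it is dense below `p` to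
extend `c`. -/
def inGeneric (c : P) : Stmt P := fun p => ∀ q ≤ p, ∃ r ≤ q, r ≤ c

/-- `P ⊩ φ`: every condition forces `φ`. -/
def Forced (φ : Stmt P) : Prop := ∀ p, φ p

end Relation

section Names

variable {P : Type} [Preorder P] [OrderTop P]

/-- The canonical name `x̌` of a ground model set `x`. -/
def check : PSet.{0} → PName P
  | ⟨ι, a⟩ => ⟨ι, fun i => check (a i), fun _ => ⊤⟩

/-- The canonical name of a natural number (a von Neumann ordinal). -/
def natName (n : ℕ) : PName P := check (PSet.ofNat n)

/-- The canonical name of the set `ω`. -/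
def omegaName : PName P := check ⟨ℕ, PSet.ofNat⟩

/-- A subset of `ω` as a set of the ground model. -/
def natSet (Y : Set ℕ) : PSet.{0} := ⟨Y, fun n => PSet.ofNat n⟩

/-- The canonical name of a subset of `ω` of the ground model. -/
def subsetName (Y : Set ℕ) : PName P := check (natSet Y)

/-- The canonical name of a set of subsets of `ω` of the ground model. -/
def familyName (F : Set (Set ℕ)) : PName P := check ⟨F, fun Y => natSet Y⟩

/-- The name of the unordered pair of (the objects named by) `x` and `y`. -/
def upair (x y : PName P) : PName P := ⟨Bool, fun b => if b then x else y, fun _ => ⊤⟩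

/-- The name of the (Kuratowski) ordered pair of `x` and `y`. -/
def opair (x y : PName P) : PName P := upair (upair x x) (upair x y)

end Names

/-! ### Statements about the Cantor space of the generic extension

As in the ground model, points of `2^ω` are identified with subsets of `ω`. -/

section Statements

variable {P : Type} [Preorder P] [OrderTop P]

/-- "`x ∈ 2^ω`", that is, `x` is a subset of `ω`. -/
def isReal (x : PName P) : Stmt P := all fun z : PName P => imp (mem z x) (mem z omegaName)

/-- "`x ∈ [x(n) = 1]`", that is, `n ∈ x`. -/
def bit (n : ℕ) (x : PName P) : Stmt P := mem (natName n) x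

/-- "`x ↾ n = s`" for a finite sequence `s ∈ 2^n`. -/
def restrIs (n : ℕ) (x : PName P) (s : Fin n → Bool) : Stmt P :=
  all fun i : Fin n => iff (bit i x) (ground (s i = true))

/-- "`x ↾ n = y ↾ n`". -/
def agree (n : ℕ) (x y : PName P) : Stmt P := all fun i : Fin n => iff (bit i x) (bit i y)

/-- "`h(x) = y`", that is, `(x, y) ∈ h`. -/
def app (h x y : PName P) : Stmt P := mem (opair x y) h

/-- "`h` is a function from `2^ω` to `2^ω`". -/
def isMap (h : PName P) : Stmt P :=
  and
    (all fun z : PName P => imp (mem z h)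
      (ex fun x : PName P => ex fun y : PName P =>
        and (and (isReal x) (isReal y)) (eq z (opair x y))))
    (and
      (all fun x : PName P => imp (isReal x) (ex fun y : PName P => app h x y))
      (all fun x : PName P => all fun y : PName P => all fun y' : PName P =>
        imp (and (app h x y) (app h x y')) (eq y y')))

/-- "`h` is injective". -/
def isInjective (h : PName P) : Stmt P :=
  all fun x : PName P => all fun x' : PName P => all fun y : PName P =>
    imp (and (app h x y) (app h x' y)) (eq x x')

/-- "`h` is onto `2^ω`". -/
def isSurjective (h : PName P) : Stmt P :=
  all fun y : PName P => imp (isReal y) (ex fun x : PName P => app h x y)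

/-- "`h` is continuous". -/
def isContinuous (h : PName P) : Stmt P :=
  all fun x : PName P => all fun y : PName P => imp (app h x y)
    (all fun m : ℕ => ex fun k : ℕ => all fun x' : PName P => all fun y' : PName P =>
      imp (and (app h x' y') (agree k x x')) (agree m y y'))

/-- "the inverse of `h` is continuous". -/
def isInvContinuous (h : PName P) : Stmt P :=
  all fun x : PName P => all fun y : PName P => imp (app h x y)
    (all fun m : ℕ => ex fun k : ℕ => all fun x' : PName P => all fun y' : PName P =>
      imp (and (app h x' y') (agree k y y')) (agree m x x'))

/-- "`h` is a homeomorphism from `2^ω` to `2^ω`". -/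
def isHomeo (h : PName P) : Stmt P :=
  and (isMap h) (and (and (isInjective h) (isSurjective h))
    (and (isContinuous h) (isInvContinuous h)))

/-- The canonical name of a set of points of the ground model's `2^ω`. -/
def pointsName (S : Set Cantor) : PName P := familyName (supp '' S)

/-- "`h '' A = B`". -/
def imageEq (h A B : PName P) : Stmt P :=
  all fun y : PName P => iff (mem y B) (ex fun x : PName P => and (mem x A) (app h x y))

/-- "`h '' [x(n) = 1] = [x(n) = 1]`". -/
def fixesBit (h : PName P) (n : ℕ) : Stmt P :=
  all fun y : PName P => iff (and (isReal y) (bit n y))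
    (ex fun x : PName P => and (and (isReal x) (bit n x)) (app h x y))

/-- "there are infinitely many `n ∈ Y` such that `φ n`". -/
def infinitelyMany (Y : PName P) (φ : ℕ → Stmt P) : Stmt P :=
  all fun k : ℕ => ex fun n : ℕ => and (and (ground (k ≤ n)) (bit n Y)) (φ n)

/-- "`Y` is a pseudointersection of `T`": `Y` is an infinite subset of `ω` and `Y ⊆^* Z` for
all `Z ∈ T`. -/
def isPseudointersection (Y T : PName P) : Stmt P :=
  and (and (isReal Y) (infinitelyMany Y fun _ => ground True))
    (all fun Z : PName P => imp (mem Z T)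
      (ex fun k : ℕ => all fun n : ℕ => imp (and (ground (k ≤ n)) (bit n Y)) (bit n Z)))

end Statements

section GenericMap

variable {I : Type} {A B : Set Cantor} {Apart Bpart : I → Set Cantor}

/-- `h` is a name of the generic map `2^ω → 2^ω` added by `𝕄_{A,B}`: the function given by
`h(x) ↾ n_p = π_p(x ↾ n_p)` for all `x` in `2^ω` and all `p` in the generic filter. -/
def IsGenericMap (h : PName (Medini A B Apart Bpart)) : Prop :=
  Forced (and (isMap h)
    (all fun p : Medini A B Apart Bpart => imp (inGeneric p)
      (all fun x : PName (Medini A B Apart Bpart) => all fun y : PName (Medini A B Apart Bpart) =>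
        imp (app h x y)
          (all fun s : Fin p.len → Bool =>
            imp (restrIs p.len x s) (restrIs p.len y (p.perm s))))))

/-- "`h` extends `f_p` for every `p` in the generic filter". -/
def extendsGeneric (h : PName (Medini A B Apart Bpart)) : Stmt (Medini A B Apart Bpart) :=
  all fun p : Medini A B Apart Bpart => imp (inGeneric p)
    (all fun z : p.graph => app h (subsetName (supp z.1.1)) (subsetName (supp z.1.2)))

end GenericMap

end Forcing

/-! For σ-centeredness, a condition is described by countably much data. There are at most continuum
many levels, so finitely many of them are told apart by finite binary strings, and each level is
countable, so a point on it has a natural number index. Conditions with the same description have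
the same permutation, and their finite maps fit together (`Medini.sigmaCentered`).

The permutations in the generic filter cohere and their lengths are unbounded, so they define a map
of `2^ω`. Each `π_p` controls both `h` and its inverse up to length `n_p`, so `h` is a
homeomorphism. Since the levels are dense, any point of `A` can be put into the domain of some `f_p`
and any point of `B` into the range (`Medini.exists_le_mem_domain`, `Medini.exists_le_mem_range`),
whence `h '' A = B`.

The tower enters through `Medini.exists_le_fixesCoord_mem`. The finitely many points of `dom f_p`
are complements of tower members, whose intersection with `X` is infinite; on it all these points
are `0`, and so are their images at almost all places, because elements of `B` almost avoid `X`. At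
such a place `n` the permutation may be extended by the identity on coordinate `n`, so `h` preserves
`[x(n) = 1]`. The set of such `n` in `X` is the pseudointersection: if `n` is in it but not in `Z ∈
T`, then `h` of the complement of `Z` contains `n`; this image is in `B`, so it has only finitely
many elements in `X`. -/

namespace Forcing

/-! ### Regular statements and the equality axioms for the forcing relation -/

section Basic

variable {P : Type} [Preorder P]

/-- A statement is regular if the set of conditions forcing it is closed under extensions and
contains every condition below which it is dense. -/
class IsRegular (φ : Stmt P) : Prop where
  mono : ∀ {p q : P}, q ≤ p → φ p → φ q
  dense : ∀ {p : P}, (∀ q ≤ p, ∃ r ≤ q, φ r) → φ p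

theorem mono {φ : Stmt P} [IsRegular φ] {p q : P} (hq : q ≤ p) (h : φ p) : φ q :=
  IsRegular.mono hq h

theorem of_dense {φ : Stmt P} [IsRegular φ] {p : P} (h : ∀ q ≤ p, ∃ r ≤ q, φ r) : φ p :=
  IsRegular.dense h

instance (x y : PName P) : IsRegular (eq x y) := by
  obtain ⟨ι, a, s⟩ := x
  obtain ⟨κ, b, t⟩ := y
  constructor
  · intro p q hq h
    exact ⟨fun i r hr => h.1 i r (hr.trans hq), fun j r hr => h.2 j r (hr.trans hq)⟩
  · intro p h
    constructor
    · intro i q hq hs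
      obtain ⟨r, hr, e⟩ := h q hq
      obtain ⟨r', hr', e'⟩ := e.1 i r le_rfl (hr.trans hs)
      exact ⟨r', hr'.trans hr, e'⟩
    · intro i q hq hs
      obtain ⟨r, hr, e⟩ := h q hq
      obtain ⟨r', hr', e'⟩ := e.2 i r le_rfl (hr.trans hs)
      exact ⟨r', hr'.trans hr, e'⟩

instance (x y : PName P) : IsRegular (mem x y) := by
  obtain ⟨κ, b, t⟩ := y
  constructor
  · intro p q hq h r hr
    exact h r (hr.trans hq)
  · intro p h q hq
    obtain ⟨r, hr, e⟩ := h q hq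
    obtain ⟨r', hr', e'⟩ := e r le_rfl
    exact ⟨r', hr'.trans hr, e'⟩

instance (a : Prop) : IsRegular (ground a : Stmt P) :=
  ⟨fun _ h => h, fun h => (h _ le_rfl).choose_spec.2⟩

instance (φ ψ : Stmt P) [IsRegular φ] [IsRegular ψ] : IsRegular (and φ ψ) :=
  ⟨fun hq h => ⟨mono hq h.1, mono hq h.2⟩, fun h =>
    ⟨of_dense fun q hq => let ⟨r, hr, e⟩ := h q hq; ⟨r, hr, e.1⟩,
      of_dense fun q hq => let ⟨r, hr, e⟩ := h q hq; ⟨r, hr, e.2⟩⟩⟩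

instance (φ ψ : Stmt P) [IsRegular φ] [IsRegular ψ] : IsRegular (imp φ ψ) :=
  ⟨fun hq h r hr => h r (hr.trans hq), fun h q hq hφ => of_dense fun q' hq' =>
    let ⟨r, hr, e⟩ := h q' (hq'.trans hq)
    ⟨r, hr, e r le_rfl (mono (hr.trans hq') hφ)⟩⟩

instance (φ ψ : Stmt P) [IsRegular φ] [IsRegular ψ] : IsRegular (iff φ ψ) :=
  inferInstanceAs (IsRegular (and _ _))

instance {α : Sort*} (φ : α → Stmt P) [∀ x, IsRegular (φ x)] : IsRegular (all φ) :=
  ⟨fun hq h x => mono hq (h x), fun h x => of_dense fun q hq =>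
    let ⟨r, hr, e⟩ := h q hq
    ⟨r, hr, e x⟩⟩

theorem inGeneric_of_le {p c : P} (h : p ≤ c) : inGeneric c p :=
  fun q hq => ⟨q, le_rfl, hq.trans h⟩

theorem ex_intro {α : Sort*} {φ : α → Stmt P} [∀ x, IsRegular (φ x)] {p : P} (x : α)
    (h : φ x p) : ex φ p :=
  fun q hq => ⟨q, le_rfl, x, mono hq h⟩

theorem eq_refl (x : PName P) (p : P) : eq x x p := by
  induction x generalizing p with
  | mk ι a s ih =>
    exact ⟨fun i q _ hs => ⟨q, le_rfl, i, hs, ih i q⟩, fun i q _ hs => ⟨q, le_rfl, i, hs, ih i q⟩⟩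

theorem eq_symm {x y : PName P} {p : P} (h : eq x y p) : eq y x p := by
  induction x generalizing y p with
  | mk ι a s ih =>
    obtain ⟨κ, b, t⟩ := y
    refine ⟨fun j q hq hs => ?_, fun i q hq hs => ?_⟩
    · obtain ⟨r, hr, i, hi, e⟩ := h.2 j q hq hs
      exact ⟨r, hr, i, hi, ih i e⟩
    · obtain ⟨r, hr, j, hj, e⟩ := h.1 i q hq hs
      exact ⟨r, hr, j, hj, ih i e⟩

theorem eq_trans {x y z : PName P} {p : P} (h : eq x y p) (h' : eq y z p) : eq x z p := by
  induction x generalizing y z p with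
  | mk ι a s ih =>
    obtain ⟨κ, b, t⟩ := y
    obtain ⟨ν, c, u⟩ := z
    refine ⟨fun i q hq hs => ?_, fun k q hq hs => ?_⟩
    · obtain ⟨r, hr, j, hj, e⟩ := h.1 i q hq hs
      obtain ⟨r', hr', k, hk, e'⟩ := h'.1 j r (hr.trans hq) hj
      exact ⟨r', hr'.trans hr, k, hk, ih i (mono hr' e) e'⟩
    · obtain ⟨r, hr, j, hj, e⟩ := h'.2 k q hq hs
      obtain ⟨r', hr', i, hi, e'⟩ := h.2 j r (hr.trans hq) hj
      exact ⟨r', hr'.trans hr, i, hi, ih i e' (mono hr' e)⟩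

theorem mem_congr_left {x y z : PName P} {p : P} (h : mem x z p) (e : eq x y p) : mem y z p := by
  obtain ⟨κ, b, t⟩ := z
  intro q hq
  obtain ⟨r, hr, j, hj, e'⟩ := h q hq
  exact ⟨r, hr, j, hj, eq_trans (eq_symm (mono (hr.trans hq) e)) e'⟩

theorem mem_congr_right {x y z : PName P} {p : P} (h : mem x y p) (e : eq y z p) : mem x z p := by
  obtain ⟨κ, b, t⟩ := y
  obtain ⟨ν, c, u⟩ := z
  intro q hq
  obtain ⟨r, hr, j, hj, e'⟩ := h q hq
  obtain ⟨r', hr', k, hk, e''⟩ := e.1 j r (hr.trans hq) hj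
  exact ⟨r', hr'.trans hr, k, hk, eq_trans (mono hr' e') e''⟩

/-- Extensionality is tested on the constituents of the two names: a constituent is forced into its
name below its own condition. -/
theorem eq_of_mem_iff {x y : PName P} {p : P} (h : ∀ z, iff (mem z x) (mem z y) p) :
    eq x y p := by
  obtain ⟨ι, a, s⟩ := x
  obtain ⟨κ, b, t⟩ := y
  refine ⟨fun i q hq hs => ?_, fun j q hq hs => ?_⟩
  · exact (h (a i)).1 q hq (fun r hr => ⟨r, le_rfl, i, hr.trans hs, eq_refl _ _⟩) q le_rfl
  · obtain ⟨r, hr, i, hi, e⟩ :=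
      (h (b j)).2 q hq (fun r hr => ⟨r, le_rfl, j, hr.trans hs, eq_refl _ _⟩) q le_rfl
    exact ⟨r, hr, i, hi, eq_symm e⟩

/-- If no extension of `p` forces `φ`, then `p` itself forces the implication from `φ` to falsity
vacuously. -/
theorem exists_decides (φ : Stmt P) [IsRegular φ] (p : P) :
    ∃ q ≤ p, ∃ b : Bool, iff φ (ground (b = true)) q := by
  by_cases h : ∃ q ≤ p, φ q
  · obtain ⟨q, hq, e⟩ := h
    exact ⟨q, hq, true, fun _ _ _ => rfl, fun r hr _ => mono hr e⟩
  · push Not at h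
    exact ⟨p, le_rfl, false, fun r hr e => (h r hr e).elim, fun r hr e => by cases e⟩

end Basic

/-! ### Check names and ordered pairs -/

section Names

variable {P : Type} [Preorder P] [OrderTop P]

theorem mem_check_iff {z : PName P} {y : PSet.{0}} {p : P} :
    mem z (check y) p ↔ ∀ q ≤ p, ∃ r ≤ q, ∃ j : y.Type, eq z (check (y.Func j)) r := by
  obtain ⟨κ, b⟩ := y
  constructor
  · intro h q hq
    obtain ⟨r, hr, j, -, e⟩ := h q hq
    exact ⟨r, hr, j, e⟩
  · intro h q hq
    obtain ⟨r, hr, j, e⟩ := h q hq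
    exact ⟨r, hr, j, le_top, e⟩

theorem eq_check_iff {x y : PSet.{0}} {p : P} : eq (check x) (check y) p ↔ PSet.Equiv x y := by
  induction x generalizing y p with
  | mk ι a ih =>
    obtain ⟨κ, b⟩ := y
    constructor
    · intro h
      refine ⟨fun i => ?_, fun j => ?_⟩
      · obtain ⟨r, -, j, -, e⟩ := h.1 i p le_rfl le_top
        exact ⟨j, (ih i).1 e⟩
      · obtain ⟨r, -, i, -, e⟩ := h.2 j p le_rfl le_top
        exact ⟨i, (ih i).1 e⟩
    · intro h
      refine ⟨fun i q _ _ => ?_, fun j q _ _ => ?_⟩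
      · obtain ⟨j, e⟩ := h.1 i
        exact ⟨q, le_rfl, j, le_top, (ih i).2 e⟩
      · obtain ⟨i, e⟩ := h.2 j
        exact ⟨q, le_rfl, i, le_top, (ih i).2 e⟩

/-- The rank is invariant under `PSet.Equiv`, so it distinguishes the names of different natural
numbers. -/
theorem rank_ofNat (n : ℕ) : (PSet.ofNat.{0} n).rank = n := by
  induction n with
  | zero => simp [PSet.ofNat]
  | succ n ih =>
    rw [PSet.ofNat, PSet.rank_insert, ih, max_eq_left (Order.le_succ _)]
    simp

theorem eq_natName_iff {m n : ℕ} {p : P} : eq (natName m) (natName n) p ↔ m = n := by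
  constructor
  · intro h
    have := PSet.rank_congr (eq_check_iff.1 h)
    rw [rank_ofNat, rank_ofNat] at this
    exact_mod_cast this
  · rintro rfl
    exact eq_refl _ _

theorem mem_omegaName_iff {z : PName P} {p : P} :
    mem z omegaName p ↔ ∀ q ≤ p, ∃ r ≤ q, ∃ n : ℕ, eq z (natName n) r :=
  mem_check_iff

theorem mem_subsetName_iff {z : PName P} {Y : Set ℕ} {p : P} :
    mem z (subsetName Y) p ↔ ∀ q ≤ p, ∃ r ≤ q, ∃ n : Y, eq z (natName n) r :=
  mem_check_iff

theorem mem_familyName_iff {z : PName P} {F : Set (Set ℕ)} {p : P} :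
    mem z (familyName F) p ↔ ∀ q ≤ p, ∃ r ≤ q, ∃ Y : F, eq z (subsetName Y) r :=
  mem_check_iff

theorem mem_familyName_of_mem {F : Set (Set ℕ)} {Y : Set ℕ} (hY : Y ∈ F) (p : P) :
    mem (subsetName Y) (familyName F) p :=
  mem_familyName_iff.2 fun q _ => ⟨q, le_rfl, ⟨Y, hY⟩, eq_refl _ _⟩

theorem mem_upair_iff {x y z : PName P} {p : P} :
    mem z (upair x y) p ↔ ∀ q ≤ p, ∃ r ≤ q, eq z x r ∨ eq z y r := by
  constructor
  · intro h q hq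
    obtain ⟨r, hr, j, -, e⟩ := h q hq
    cases j
    · exact ⟨r, hr, .inr e⟩
    · exact ⟨r, hr, .inl e⟩
  · intro h q hq
    obtain ⟨r, hr, e | e⟩ := h q hq
    · exact ⟨r, hr, true, le_top, e⟩
    · exact ⟨r, hr, false, le_top, e⟩

theorem left_mem_upair (x y : PName P) (p : P) : mem x (upair x y) p :=
  mem_upair_iff.2 fun q _ => ⟨q, le_rfl, .inl (eq_refl _ _)⟩

theorem right_mem_upair (x y : PName P) (p : P) : mem y (upair x y) p :=
  mem_upair_iff.2 fun q _ => ⟨q, le_rfl, .inr (eq_refl _ _)⟩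

theorem upair_congr {x y x' y' : PName P} {p : P} (hx : eq x x' p) (hy : eq y y' p) :
    eq (upair x y) (upair x' y') p := by
  refine eq_of_mem_iff fun z => ⟨fun q hq h => ?_, fun q hq h => ?_⟩
  · refine mem_upair_iff.2 fun q' hq' => ?_
    obtain ⟨r, hr, e | e⟩ := mem_upair_iff.1 h q' hq'
    · exact ⟨r, hr, .inl (eq_trans e (mono (hr.trans (hq'.trans hq)) hx))⟩
    · exact ⟨r, hr, .inr (eq_trans e (mono (hr.trans (hq'.trans hq)) hy))⟩
  · refine mem_upair_iff.2 fun q' hq' => ?_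
    obtain ⟨r, hr, e | e⟩ := mem_upair_iff.1 h q' hq'
    · exact ⟨r, hr, .inl (eq_trans e (eq_symm (mono (hr.trans (hq'.trans hq)) hx)))⟩
    · exact ⟨r, hr, .inr (eq_trans e (eq_symm (mono (hr.trans (hq'.trans hq)) hy)))⟩

theorem opair_congr {x y x' y' : PName P} {p : P} (hx : eq x x' p) (hy : eq y y' p) :
    eq (opair x y) (opair x' y') p :=
  upair_congr (upair_congr hx hx) (upair_congr hx hy)

theorem eq_of_upair_self_eq {x u v : PName P} {p : P} (h : eq (upair x x) (upair u v) p) :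
    eq u x p ∧ eq v x p := by
  refine ⟨of_dense fun q hq => ?_, of_dense fun q hq => ?_⟩
  · obtain ⟨r, hr, e | e⟩ :=
      mem_upair_iff.1 (mem_congr_right (left_mem_upair u v p) (eq_symm h)) q hq <;>
    exact ⟨r, hr, e⟩
  · obtain ⟨r, hr, e | e⟩ :=
      mem_upair_iff.1 (mem_congr_right (right_mem_upair u v p) (eq_symm h)) q hq <;>
    exact ⟨r, hr, e⟩

theorem fst_eq_of_opair_eq {x y x' y' : PName P} {p : P}
    (h : eq (opair x y) (opair x' y') p) : eq x x' p := by
  refine of_dense fun q hq => ?_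
  obtain ⟨r, hr, e | e⟩ := mem_upair_iff.1 (mem_congr_right (left_mem_upair _ _ p) h) q hq
  · exact ⟨r, hr, eq_symm (eq_of_upair_self_eq e).1⟩
  · exact ⟨r, hr, eq_symm (eq_of_upair_self_eq e).1⟩

/-- If `(x, y) = (x', y')`, then `y` is `y'` or both `x` and `x'`. -/
theorem snd_eq_or_of_opair_eq {x y x' y' : PName P} {p : P}
    (h : eq (opair x y) (opair x' y') p) : ∃ r ≤ p, eq y y' r ∨ eq y x r := by
  have hx := fst_eq_of_opair_eq h
  obtain ⟨r, hr, e | e⟩ := mem_upair_iff.1 (mem_congr_right (right_mem_upair _ _ p) h) p le_rfl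
  · exact ⟨r, hr, .inr (eq_trans (eq_of_upair_self_eq (eq_symm e)).2 (eq_symm (mono hr hx)))⟩
  · obtain ⟨r', hr', e' | e'⟩ :=
      mem_upair_iff.1 (mem_congr_right (right_mem_upair _ _ r) e) r le_rfl
    · exact ⟨r', hr'.trans hr, .inr (eq_trans e' (eq_symm (mono (hr'.trans hr) hx)))⟩
    · exact ⟨r', hr'.trans hr, .inl e'⟩

theorem snd_eq_of_opair_eq {x y x' y' : PName P} {p : P}
    (h : eq (opair x y) (opair x' y') p) : eq y y' p := by
  refine of_dense fun q hq => ?_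
  obtain ⟨r, hr, e | e⟩ := snd_eq_or_of_opair_eq (mono hq h)
  · exact ⟨r, hr, e⟩
  · obtain ⟨r', hr', e' | e'⟩ := snd_eq_or_of_opair_eq (eq_symm (mono (hr.trans hq) h))
    · exact ⟨r', hr'.trans hr, eq_symm e'⟩
    -- Degenerate case, where both pairs have equal coordinates: `y = x = x' = y'`.
    · have hx := mono (hr'.trans (hr.trans hq)) (fst_eq_of_opair_eq h)
      exact ⟨r', hr'.trans hr, eq_trans (eq_trans (mono hr' e) hx) (eq_symm e')⟩

end Names

/-! ### Names of reals and their finite restrictions -/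

section Reals

variable {P : Type} [Preorder P] [OrderTop P]

instance (x : PName P) : IsRegular (isReal x) := inferInstanceAs (IsRegular (all _))

instance (n : ℕ) (x : PName P) : IsRegular (bit n x) := inferInstanceAs (IsRegular (mem _ _))

instance (n : ℕ) (x : PName P) (s : Fin n → Bool) : IsRegular (restrIs n x s) :=
  inferInstanceAs (IsRegular (all _))

instance (n : ℕ) (x y : PName P) : IsRegular (agree n x y) :=
  inferInstanceAs (IsRegular (all _))

instance (h x y : PName P) : IsRegular (app h x y) := inferInstanceAs (IsRegular (mem _ _))

theorem isReal_congr {x y : PName P} {p : P} (h : isReal x p) (e : eq x y p) : isReal y p :=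
  fun z q hq hz => h z q hq (mem_congr_right hz (eq_symm (mono hq e)))

theorem bit_congr {n : ℕ} {x y : PName P} {p : P} (h : bit n x p) (e : eq x y p) : bit n y p :=
  mem_congr_right h e

theorem app_congr {h x y x' y' : PName P} {p : P} (ha : app h x y p) (hx : eq x x' p)
    (hy : eq y y' p) : app h x' y' p :=
  mem_congr_left ha (opair_congr hx hy)

theorem isReal.ext {x y : PName P} {p : P} (hx : isReal x p) (hy : isReal y p)
    (h : ∀ n, iff (bit n x) (bit n y) p) : eq x y p := by
  refine eq_of_mem_iff fun z => ⟨fun q hq hz => ?_, fun q hq hz => ?_⟩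
  · refine of_dense fun q' hq' => ?_
    obtain ⟨r, hr, n, e⟩ := mem_omegaName_iff.1 (hx z q hq hz) q' hq'
    refine ⟨r, hr, mem_congr_left ((h n).1 r (hr.trans (hq'.trans hq)) ?_) (eq_symm e)⟩
    exact mem_congr_left (mono (hr.trans hq') hz) e
  · refine of_dense fun q' hq' => ?_
    obtain ⟨r, hr, n, e⟩ := mem_omegaName_iff.1 (hy z q hq hz) q' hq'
    refine ⟨r, hr, mem_congr_left ((h n).2 r (hr.trans (hq'.trans hq)) ?_) (eq_symm e)⟩
    exact mem_congr_left (mono (hr.trans hq') hz) e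

theorem isReal_subsetName (Y : Set ℕ) (p : P) : isReal (subsetName Y) p := by
  intro z q _ hz
  refine mem_omegaName_iff.2 fun q' hq' => ?_
  obtain ⟨r, hr, n, e⟩ := mem_subsetName_iff.1 hz q' hq'
  exact ⟨r, hr, n, e⟩

theorem bit_subsetName_iff {n : ℕ} {Y : Set ℕ} {p : P} : bit n (subsetName Y) p ↔ n ∈ Y := by
  constructor
  · intro h
    obtain ⟨r, -, m, e⟩ := mem_subsetName_iff.1 h p le_rfl
    rw [eq_natName_iff.1 e]
    exact m.2
  · intro h
    exact mem_subsetName_iff.2 fun q _ => ⟨q, le_rfl, ⟨n, h⟩, eq_refl _ _⟩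

theorem restrIs_subsetName_supp (n : ℕ) (a : Cantor) (p : P) :
    restrIs n (subsetName (supp a)) (restr n a) p :=
  fun _ => ⟨fun _ _ h => bit_subsetName_iff.1 h, fun _ _ h => bit_subsetName_iff.2 h⟩

/-- The name of the set of those `n` for which some element of `f n` is in the generic filter. -/
def niceName (f : ℕ → Set P) : PName P := ⟨Σ n, f n, fun i => natName i.1, fun i => i.2⟩

theorem isReal_niceName (f : ℕ → Set P) (p : P) : isReal (niceName f) p := by
  intro z q _ hz
  refine mem_omegaName_iff.2 fun q' hq' => ?_
  obtain ⟨r, hr, i, -, e⟩ := hz q' hq'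
  exact ⟨r, hr, i.1, e⟩

theorem bit_niceName_iff {n : ℕ} {f : ℕ → Set P} {p : P} :
    bit n (niceName f) p ↔ ∀ q ≤ p, ∃ r ≤ q, ∃ c ∈ f n, r ≤ c := by
  constructor
  · intro h q hq
    obtain ⟨r, hr, ⟨m, c, hc⟩, hrc, e⟩ := h q hq
    obtain rfl : n = m := eq_natName_iff.1 e
    exact ⟨r, hr, c, hc, hrc⟩
  · intro h q hq
    obtain ⟨r, hr, c, hc, hrc⟩ := h q hq
    exact ⟨r, hr, ⟨n, c, hc⟩, hrc, eq_refl _ _⟩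

/-- All names form a type in a higher universe and cannot index a name. Nice names are indexed by `ℕ
→ Set P`, a small type, and represent every real; this is what makes `genericMapName` a name. -/
theorem isReal.eq_niceName {x : PName P} {p : P} (hx : isReal x p) :
    eq x (niceName fun n => {c | bit n x c}) p := by
  refine hx.ext (isReal_niceName _ _) fun n => ⟨fun q _ h => ?_, fun q _ h => ?_⟩
  · exact bit_niceName_iff.2 fun r hr => ⟨r, le_rfl, r, mono (φ := bit n x) hr h, le_rfl⟩
  · refine of_dense fun q' hq' => ?_
    obtain ⟨r, hr, c, hc, hrc⟩ := bit_niceName_iff.1 h q' hq'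
    exact ⟨r, hr, mono (φ := bit n x) hrc hc⟩

theorem restrIs_unique {n : ℕ} {x : PName P} {s t : Fin n → Bool} {p : P}
    (hs : restrIs n x s p) (ht : restrIs n x t p) : s = t := by
  funext i
  rw [Bool.eq_iff_iff]
  exact ⟨fun h => (ht i).1 p le_rfl ((hs i).2 p le_rfl h),
    fun h => (hs i).1 p le_rfl ((ht i).2 p le_rfl h)⟩

theorem restrIs_restrFin {n m : ℕ} (h : n ≤ m) {x : PName P} {t : Fin m → Bool} {p : P}
    (ht : restrIs m x t p) : restrIs n x (restrFin h t) p :=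
  fun i => ht (Fin.castLE h i)

theorem agree_of_restrIs {n : ℕ} {x y : PName P} {s : Fin n → Bool} {p : P}
    (hx : restrIs n x s p) (hy : restrIs n y s p) : agree n x y p :=
  fun i => ⟨fun q hq h => (hy i).2 q hq ((hx i).1 q hq h),
    fun q hq h => (hx i).2 q hq ((hy i).1 q hq h)⟩

theorem restrIs_of_agree {n : ℕ} {x y : PName P} {s : Fin n → Bool} {p : P}
    (h : agree n x y p) (hx : restrIs n x s p) : restrIs n y s p :=
  fun i => ⟨fun q hq e => (hx i).1 q hq ((h i).2 q hq e),
    fun q hq e => (h i).1 q hq ((hx i).2 q hq e)⟩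

theorem restrIs_congr {n : ℕ} {x y : PName P} {s : Fin n → Bool} {p : P}
    (h : eq x y p) (hx : restrIs n x s p) : restrIs n y s p :=
  restrIs_of_agree (fun _ => ⟨fun _ hq e => bit_congr e (mono hq h),
    fun _ hq e => bit_congr e (eq_symm (mono hq h))⟩) hx

theorem exists_restrIs (n : ℕ) (x : PName P) (p : P) : ∃ q ≤ p, ∃ s, restrIs n x s q := by
  induction n with
  | zero => exact ⟨p, le_rfl, fun i => i.elim0, fun i => i.elim0⟩
  | succ n ih =>
    obtain ⟨q, hq, s, hs⟩ := ih
    obtain ⟨r, hr, b, hb⟩ := exists_decides (bit n x) q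
    refine ⟨r, hr.trans hq, Fin.snoc s b, fun i => ?_⟩
    induction i using Fin.lastCases with
    | last => simpa using hb
    | cast i => simpa using mono hr (hs i)

end Reals

end Forcing

/-! ### Finite restrictions and lifting of permutations -/

theorem eventually_injOn_restr {F : Set Cantor} (hF : F.Finite) :
    ∀ᶠ m in Filter.atTop, Set.InjOn (restr m) F := by
  have key : ∀ x ∈ F, ∀ y ∈ F, ∀ᶠ m in Filter.atTop, restr m x = restr m y → x = y := by
    intro x _ y _
    by_cases h : x = y
    · simp [h]
    · obtain ⟨k, hk⟩ := Function.ne_iff.1 h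
      filter_upwards [Filter.eventually_gt_atTop k] with m hm e
      exact (hk (congrFun e ⟨k, hm⟩)).elim
  have := (hF.eventually_all).2 fun x hx => (hF.eventually_all).2 (key x hx)
  filter_upwards [this] with m hm x hx y hy e
  exact hm x hx y hy e

theorem Dense.exists_restr_eq {D : Set Cantor} (hD : Dense D) {n : ℕ} (s : Fin n → Bool) :
    ∃ x ∈ D, restr n x = s := by
  have hc : Continuous (restr n) := by unfold restr; fun_prop
  obtain ⟨x, hx, hxD⟩ := hD.inter_open_nonempty _ ((isOpen_discrete {s}).preimage hc)
    ⟨fun i => if h : i < n then s ⟨i, h⟩ else false, by ext i; simp [restr]⟩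
  exact ⟨x, hxD, hx⟩

theorem restrFin_restr {n m : ℕ} (h : n ≤ m) (x : Cantor) : restrFin h (restr m x) = restr n x :=
  rfl

/-- A permutation of `2^n` acts on `2^m` by its action on the first `n` coordinates. -/
def liftPerm {n m : ℕ} (h : n ≤ m) (π : Equiv.Perm (Fin n → Bool)) :
    Equiv.Perm (Fin m → Bool) where
  toFun t i := if hi : (i : ℕ) < n then π (restrFin h t) ⟨i, hi⟩ else t i
  invFun t i := if hi : (i : ℕ) < n then π.symm (restrFin h t) ⟨i, hi⟩ else t i
  left_inv t := by
    have : restrFin h (fun i => if hi : (i : ℕ) < n then π (restrFin h t) ⟨i, hi⟩ else t i) =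
        π (restrFin h t) := by ext i; simp [restrFin]
    simp only [this]
    ext i
    by_cases hi : (i : ℕ) < n <;> simp [hi, restrFin]
  right_inv t := by
    have : restrFin h (fun i => if hi : (i : ℕ) < n then π.symm (restrFin h t) ⟨i, hi⟩ else t i) =
        π.symm (restrFin h t) := by ext i; simp [restrFin]
    simp only [this]
    ext i
    by_cases hi : (i : ℕ) < n <;> simp [hi, restrFin]

theorem restrFin_liftPerm {n m : ℕ} (h : n ≤ m) (π : Equiv.Perm (Fin n → Bool))
    (t : Fin m → Bool) : restrFin h (liftPerm h π t) = π (restrFin h t) := by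
  ext i
  simp [restrFin, liftPerm]

theorem liftPerm_apply_of_le {n m : ℕ} (h : n ≤ m) (π : Equiv.Perm (Fin n → Bool))
    (t : Fin m → Bool) {i : Fin m} (hi : n ≤ i) : liftPerm h π t i = t i := by
  simp [liftPerm, hi]

/-- The prescribed values are installed one at a time by composing with a swap of `σ z.1` and `z.2`.
Both lie over the same sequence of length `n`, so the result still lifts `π`; by `hS` the swap moves
none of the values already installed. -/
theorem exists_perm_lift {n m : ℕ} (h : n ≤ m) (π : Equiv.Perm (Fin n → Bool))
    (S : Finset ((Fin m → Bool) × (Fin m → Bool)))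
    (hS : ∀ z ∈ S, ∀ w ∈ S, z.1 = w.1 ↔ z.2 = w.2)
    (hπ : ∀ z ∈ S, restrFin h z.2 = π (restrFin h z.1)) :
    ∃ σ : Equiv.Perm (Fin m → Bool), (∀ t, restrFin h (σ t) = π (restrFin h t)) ∧
      ∀ z ∈ S, σ z.1 = z.2 := by
  classical
  induction S using Finset.induction_on with
  | empty => exact ⟨liftPerm h π, restrFin_liftPerm h π, by simp⟩
  | insert z S hz ih =>
    obtain ⟨σ, hσ, hσS⟩ := ih
      (fun w hw v hv => hS w (Finset.mem_insert_of_mem hw) v (Finset.mem_insert_of_mem hv))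
      (fun w hw => hπ w (Finset.mem_insert_of_mem hw))
    have hzπ := hπ z (Finset.mem_insert_self _ _)
    refine ⟨σ.trans (Equiv.swap (σ z.1) z.2), fun t => ?_, fun w hw => ?_⟩
    · simp only [Equiv.trans_apply]
      rw [← hσ]
      have e : restrFin h (σ z.1) = restrFin h z.2 := by rw [hσ, hzπ]
      by_cases h1 : σ t = σ z.1
      · rw [h1, Equiv.swap_apply_left, e]
      · by_cases h2 : σ t = z.2
        · rw [h2, Equiv.swap_apply_right, e]
        · rw [Equiv.swap_apply_of_ne_of_ne h1 h2]
    · simp only [Equiv.trans_apply]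
      rcases Finset.mem_insert.1 hw with rfl | hw'
      · exact Equiv.swap_apply_left _ _
      · have hne : w ≠ z := fun e => hz (e ▸ hw')
        have hiff := hS w hw z (Finset.mem_insert_self _ _)
        have h1 : w.1 ≠ z.1 := fun e => hne (Prod.ext e (hiff.1 e))
        have h2 : w.2 ≠ z.2 := fun e => h1 (hiff.2 e)
        rw [Equiv.swap_apply_of_ne_of_ne, hσS w hw']
        · exact fun e => h1 (σ.injective e)
        · rwa [hσS w hw']

/-! ### Density arguments and σ-centeredness -/

namespace Medini

variable {I : Type} {A B : Set Cantor} {Apart Bpart : I → Set Cantor}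

/-- Once `m` separates the points of the domain and those of the range, `exists_perm_lift` applies.
Every large `m` is attained as an exact length, so the length can be chosen in a given infinite set.
-/
theorem eventually_exists_le (p : Medini A B Apart Bpart) :
    ∀ᶠ m in Filter.atTop, ∃ q ≤ p, q.len = m ∧ q.graph = p.graph := by
  classical
  filter_upwards [Filter.eventually_ge_atTop p.len,
    eventually_injOn_restr (p.graph.image Prod.fst).finite_toSet,
    eventually_injOn_restr (p.graph.image Prod.snd).finite_toSet] with m hm hA hB
  obtain ⟨σ, hσ, hσS⟩ := exists_perm_lift hm p.perm
    (p.graph.image fun z => (restr m z.1, restr m z.2)) (by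
      simp only [Finset.mem_image]
      rintro _ ⟨z, hz, rfl⟩ _ ⟨w, hw, rfl⟩
      constructor
      · intro e
        have := hA (by simpa using ⟨_, hz⟩) (by simpa using ⟨_, hw⟩) e
        simp only [p.functional z hz w hw this]
      · intro e
        have := hB (by simpa using ⟨_, hz⟩) (by simpa using ⟨_, hw⟩) e
        simp only [p.injective z hz w hw this]) (by
      simp only [Finset.mem_image]
      rintro _ ⟨z, hz, rfl⟩
      exact p.respects z hz)
  exact ⟨{ p with
    len := m
    perm := σ
    respects := fun z hz => (hσS _ (Finset.mem_image_of_mem _ hz)).symm },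
    ⟨fun z hz => hz, hm, hσ⟩, rfl, rfl⟩

theorem exists_le_len (p : Medini A B Apart Bpart) (n : ℕ) : ∃ q ≤ p, n ≤ q.len := by
  obtain ⟨m, ⟨q, hq, rfl, -⟩, hn⟩ :=
    ((eventually_exists_le p).and (Filter.eventually_ge_atTop n)).exists
  exact ⟨q, hq, hn⟩

theorem restrFin_perm_symm {p q : Medini A B Apart Bpart} (h : q ≤ p) (t : Fin q.len → Bool) :
    restrFin h.2.1 (q.perm.symm t) = p.perm.symm (restrFin h.2.1 t) := by
  rw [Equiv.eq_symm_apply, ← h.2.2, Equiv.apply_symm_apply]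

/-- A pair can be added to a condition if it is on one level, respects the permutation, and its
first component is already separated from the domain. -/
theorem exists_insert_le (hApart : IsCountableDensePartition A Apart)
    (hBpart : IsCountableDensePartition B Bpart) (p : Medini A B Apart Bpart)
    {a b : Cantor} {α : I} (ha : a ∈ Apart α) (hb : b ∈ Bpart α)
    (hab : restr p.len b = p.perm (restr p.len a))
    (hsep : ∀ z ∈ p.graph, restr p.len z.1 ≠ restr p.len a) :
    ∃ q ≤ p, (a, b) ∈ q.graph := by
  classical
  have hsep' : ∀ z ∈ p.graph, restr p.len z.2 ≠ restr p.len b := fun z hz e =>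
    hsep z hz (p.perm.injective (by rw [← p.respects z hz, e, hab]))
  refine ⟨{ graph := insert (a, b) p.graph
            len := p.len
            perm := p.perm
            maps := ?_
            functional := ?_
            injective := ?_
            levels := ?_
            respects := ?_ },
    ⟨Finset.subset_insert _ _, le_rfl, fun _ => rfl⟩, Finset.mem_insert_self _ _⟩
  · intro z hz
    rcases Finset.mem_insert.1 hz with rfl | hz
    · exact ⟨hApart.iUnion_eq ▸ Set.mem_iUnion_of_mem α ha,
        hBpart.iUnion_eq ▸ Set.mem_iUnion_of_mem α hb⟩
    · exact p.maps z hz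
  · intro z hz w hw e
    rcases Finset.mem_insert.1 hz with rfl | hz <;> rcases Finset.mem_insert.1 hw with rfl | hw
    · rfl
    · exact (hsep w hw (by rw [← e])).elim
    · exact (hsep z hz (by rw [e])).elim
    · exact p.functional z hz w hw e
  · intro z hz w hw e
    rcases Finset.mem_insert.1 hz with rfl | hz <;> rcases Finset.mem_insert.1 hw with rfl | hw
    · rfl
    · exact (hsep' w hw (by rw [← e])).elim
    · exact (hsep' z hz (by rw [e])).elim
    · exact p.injective z hz w hw e
  · intro z hz β
    rcases Finset.mem_insert.1 hz with rfl | hz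
    · by_cases h : β = α
      · subst h
        exact ⟨fun _ => hb, fun _ => ha⟩
      · exact ⟨fun h' => ((hApart.disjoint β α h).le_bot ⟨h', ha⟩).elim,
          fun h' => ((hBpart.disjoint β α h).le_bot ⟨h', hb⟩).elim⟩
    · exact p.levels z hz β
  · intro z hz
    rcases Finset.mem_insert.1 hz with rfl | hz
    · exact hab
    · exact p.respects z hz

/-- Lengthening the condition first separates `a` from the domain; density of the level of `a` in
`B` then supplies an image with the restriction that the permutation demands. -/
theorem exists_le_mem_domain (hApart : IsCountableDensePartition A Apart)
    (hBpart : IsCountableDensePartition B Bpart) (p : Medini A B Apart Bpart)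
    {a : Cantor} (ha : a ∈ A) : ∃ q ≤ p, ∃ b, (a, b) ∈ q.graph := by
  classical
  by_cases hdom : ∃ b, (a, b) ∈ p.graph
  · exact ⟨p, le_rfl, hdom⟩
  rw [← hApart.iUnion_eq] at ha
  obtain ⟨α, haα⟩ := Set.mem_iUnion.1 ha
  obtain ⟨m, ⟨q, hq, rfl, hg⟩, hm⟩ := ((eventually_exists_le p).and
    (eventually_injOn_restr (insert a (p.graph.image Prod.fst)).finite_toSet)).exists
  obtain ⟨b, hb, e⟩ := (hBpart.dense α).exists_restr_eq (q.perm (restr q.len a))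
  obtain ⟨r, hr, hab⟩ := exists_insert_le hApart hBpart q haα hb e fun z hz e' => by
    rw [hg] at hz
    have := hm (Finset.mem_insert_of_mem (Finset.mem_image_of_mem _ hz))
      (Finset.mem_insert_self _ _) e'
    exact hdom ⟨z.2, this ▸ hz⟩
  exact ⟨r, hr.trans hq, b, hab⟩

theorem exists_le_mem_range (hApart : IsCountableDensePartition A Apart)
    (hBpart : IsCountableDensePartition B Bpart) (p : Medini A B Apart Bpart)
    {b : Cantor} (hb : b ∈ B) : ∃ q ≤ p, ∃ a, (a, b) ∈ q.graph := by
  classical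
  by_cases hran : ∃ a, (a, b) ∈ p.graph
  · exact ⟨p, le_rfl, hran⟩
  rw [← hBpart.iUnion_eq] at hb
  obtain ⟨α, hbα⟩ := Set.mem_iUnion.1 hb
  obtain ⟨m, ⟨q, hq, rfl, hg⟩, hm⟩ := ((eventually_exists_le p).and
    (eventually_injOn_restr (insert b (p.graph.image Prod.snd)).finite_toSet)).exists
  obtain ⟨a, ha, e⟩ := (hApart.dense α).exists_restr_eq (q.perm.symm (restr q.len b))
  have hab : restr q.len b = q.perm (restr q.len a) := by rw [e, Equiv.apply_symm_apply]
  obtain ⟨r, hr, hab⟩ := exists_insert_le hApart hBpart q ha hbα hab fun z hz e' => by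
    have e'' : restr q.len z.2 = restr q.len b := by rw [q.respects z hz, e', hab]
    rw [hg] at hz
    have := hm (Finset.mem_insert_of_mem (Finset.mem_image_of_mem _ hz))
      (Finset.mem_insert_self _ _) e''
    exact hran ⟨z.1, this ▸ hz⟩
  exact ⟨r, hr.trans hq, a, hab⟩

/-- The permutation of a condition does not change the `n`-th coordinate. -/
def FixesCoord (p : Medini A B Apart Bpart) (n : ℕ) : Prop :=
  ∃ h : n < p.len, ∀ t, p.perm t ⟨n, h⟩ = t ⟨n, h⟩

theorem FixesCoord.mono {p q : Medini A B Apart Bpart} {n : ℕ} (hq : q ≤ p)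
    (h : p.FixesCoord n) : q.FixesCoord n := by
  obtain ⟨hn, hp⟩ := h
  refine ⟨hn.trans_le hq.2.1, fun t => ?_⟩
  have := congrFun (hq.2.2 t) ⟨n, hn⟩
  rw [hp] at this
  exact this

theorem FixesCoord.apply_eq {p : Medini A B Apart Bpart} {n : ℕ} (h : p.FixesCoord n)
    {z : Cantor × Cantor} (hz : z ∈ p.graph) : z.2 n = z.1 n := by
  obtain ⟨hn, hp⟩ := h
  have := congrFun (p.respects z hz) ⟨n, hn⟩
  rw [hp] at this
  exact this

/-- The condition is extended to length exactly `n` for some `n ∈ S`, and then to length `n + 1`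
with the identity on the last coordinate. The hypothesis says that the graph respects this
extension. -/
theorem exists_le_fixesCoord (p : Medini A B Apart Bpart) {S : Set ℕ} (hS : S.Infinite)
    (h : ∀ n ∈ S, ∀ z ∈ p.graph, z.2 n = z.1 n) : ∃ q ≤ p, ∃ n ∈ S, q.FixesCoord n := by
  obtain ⟨n, ⟨hn, hnS⟩⟩ := ((Nat.frequently_atTop_iff_infinite.2 hS).and_eventually
    (eventually_exists_le p)).exists
  obtain ⟨q, hq, rfl, hg⟩ := hnS
  refine ⟨{ q with
    len := q.len + 1
    perm := liftPerm (Nat.le_succ _) q.perm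
    respects := ?_ }, le_trans (b := q) ⟨fun z hz => hz, Nat.le_succ _, restrFin_liftPerm _ _⟩ hq,
    q.len, hn, Nat.lt_succ_self _, fun t => liftPerm_apply_of_le _ _ _ le_rfl⟩
  intro z hz
  ext i
  by_cases hi : (i : ℕ) < q.len
  · have := congrFun (q.respects z hz) ⟨i, hi⟩
    simpa [liftPerm, hi, restrFin_restr, restr] using this
  · rw [liftPerm_apply_of_le _ _ _ (not_lt.1 hi)]
    have : (i : ℕ) = q.len := le_antisymm (Nat.lt_succ_iff.1 i.2) (not_lt.1 hi)
    simp only [restr, this]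
    exact h _ hn z (hg ▸ hz)

/-- A center fixes the length, the permutation and a finite set of labels. Two conditions in it
cannot conflict, because their pairs on a common level carry labels from one consistent set; the
union of the graphs is then a common extension. -/
theorem sigmaCentered (hI : #I ≤ 𝔠) (hApart : IsCountableDensePartition A Apart)
    (hBpart : IsCountableDensePartition B Bpart) : SigmaCentered (Medini A B Apart Bpart) := by
  classical
  obtain ⟨c⟩ : Nonempty (I ↪ Cantor) := by
    rw [← Cardinal.le_def]
    simpa using hI
  choose eA heA using fun α => Set.countable_iff_exists_injOn.1 (hApart.countable α)
  choose eB heB using fun α => Set.countable_iff_exists_injOn.1 (hBpart.countable α)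
  -- A label records an approximation to the code of the level and the indices of both points within
  -- that level.
  let label (m : ℕ) (z : Cantor × Cantor) (α : I) : (Fin m → Bool) × ℕ × ℕ :=
    (restr m (c α), eA α z.1, eB α z.2)
  let K := (Σ n, Equiv.Perm (Fin n → Bool)) × Σ m, Finset ((Fin m → Bool) × ℕ × ℕ)
  -- The middle clause concerns `k` alone, so it also compares labels coming from different
  -- conditions.
  let center (k : K) : Set (Medini A B Apart Bpart) := {p |
    (⟨p.len, p.perm⟩ : Σ n, Equiv.Perm (Fin n → Bool)) = k.1 ∧
    (∀ u ∈ k.2.2, ∀ v ∈ k.2.2, u.1 = v.1 → (u.2.1 = v.2.1 ↔ u.2.2 = v.2.2)) ∧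
    ∀ z ∈ p.graph, ∀ α, z.1 ∈ Apart α → label k.2.1 z α ∈ k.2.2}
  have hlev : ∀ p : Medini A B Apart Bpart, ∀ z ∈ p.graph, ∃ α, z.1 ∈ Apart α := fun p z hz => by
    have := (p.maps z hz).1
    rw [← hApart.iUnion_eq] at this
    exact Set.mem_iUnion.1 this
  have huniq : ∀ {a : Cantor} {α β : I}, a ∈ Apart α → a ∈ Apart β → α = β := fun ha hb => by
    by_contra h
    exact (hApart.disjoint _ _ h).le_bot ⟨ha, hb⟩
  have hcover : ∀ p, ∃ k, p ∈ center k := by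
    intro p
    choose lev hl using hlev p
    let L : Finset I := p.graph.attach.image fun z => lev z.1 z.2
    -- With this `m`, labels of `p` with equal first entries come from the same level, so their
    -- consistency is that of `f_p`.
    obtain ⟨m, hm⟩ := (eventually_injOn_restr (L.image c).finite_toSet).exists
    refine ⟨(⟨p.len, p.perm⟩, ⟨m, p.graph.attach.image fun z => label m z.1 (lev z.1 z.2)⟩),
      rfl, ?_, ?_⟩
    · simp only [Finset.mem_image, Finset.mem_attach, true_and, Subtype.exists]
      rintro _ ⟨z, hz, rfl⟩ _ ⟨w, hw, rfl⟩ e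
      have hc : lev z hz = lev w hw := c.injective (hm
        (Finset.mem_image_of_mem _ (Finset.mem_image.2 ⟨⟨z, hz⟩, Finset.mem_attach _ _, rfl⟩))
        (Finset.mem_image_of_mem _ (Finset.mem_image.2 ⟨⟨w, hw⟩, Finset.mem_attach _ _, rfl⟩)) e)
      have hz1 := hl z hz
      have hw1 := hl w hw
      simp only [label]
      rw [← hc] at hw1 ⊢
      have hz2 := (p.levels z hz _).1 hz1
      have hw2 := (p.levels w hw _).1 hw1
      constructor
      · intro h
        rw [p.functional z hz w hw (heA _ hz1 hw1 h)]
      · intro h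
        rw [p.injective z hz w hw (heB _ hz2 hw2 h)]
    · intro z hz α hα
      rw [huniq hα (hl z hz)]
      exact Finset.mem_image.2 ⟨⟨z, hz⟩, Finset.mem_attach _ _, rfl⟩
  have hgraph : ∀ k, ∀ p ∈ center k, ∀ q ∈ center k, ∀ z ∈ p.graph, ∀ w ∈ q.graph,
      z.1 = w.1 ↔ z.2 = w.2 := by
    intro k p hp q hq z hz w hw
    obtain ⟨α, hα⟩ := hlev p z hz
    obtain ⟨β, hβ⟩ := hlev q w hw
    have hz2 := (p.levels z hz _).1 hα
    have hw2 := (q.levels w hw _).1 hβ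
    have key : α = β → (eA α z.1 = eA α w.1 ↔ eB α z.2 = eB α w.2) := by
      rintro rfl
      exact hp.2.1 _ (hp.2.2 z hz α hα) _ (hq.2.2 w hw α hβ) rfl
    constructor
    · intro e
      obtain rfl : α = β := huniq hα (e ▸ hβ)
      exact heB _ hz2 hw2 ((key rfl).1 (by rw [e]))
    · intro e
      obtain rfl : α = β := by
        by_contra h
        exact (hBpart.disjoint _ _ h).le_bot ⟨hz2, e ▸ hw2⟩
      exact heA _ hα hβ ((key rfl).2 (by rw [e]))
  have hperm : ∀ {n m : ℕ} {π : Equiv.Perm (Fin n → Bool)} {σ : Equiv.Perm (Fin m → Bool)},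
      (⟨n, π⟩ : Σ n, Equiv.Perm (Fin n → Bool)) = ⟨m, σ⟩ →
      (∃ h : n ≤ m, ∀ t, restrFin h (σ t) = π (restrFin h t)) ∧
      ∀ x y, restr n y = π (restr n x) → restr m y = σ (restr m x) := by
    rintro n m π σ ⟨⟩
    exact ⟨⟨le_rfl, fun _ => rfl⟩, fun _ _ h => h⟩
  have : Nonempty K := ⟨(⟨0, 1⟩, ⟨0, ∅⟩)⟩
  obtain ⟨g, hg⟩ := exists_surjective_nat K
  refine ⟨fun n => center (g n), fun p => ?_, fun n F hF => ?_⟩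
  · obtain ⟨k, hk⟩ := hcover p
    obtain ⟨n, rfl⟩ := hg k
    exact ⟨n, hk⟩
  · rcases F.eq_empty_or_nonempty with rfl | ⟨p₀, hp₀⟩
    · exact ⟨⊤, by simp⟩
    have hcode : ∀ p ∈ F, (⟨p.len, p.perm⟩ : Σ n, Equiv.Perm (Fin n → Bool)) =
        ⟨p₀.len, p₀.perm⟩ := fun p hp => (hF p hp).1.trans (hF p₀ hp₀).1.symm
    refine ⟨{ graph := F.biUnion fun p => p.graph
              len := p₀.len
              perm := p₀.perm
              maps := ?_
              functional := ?_
              injective := ?_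
              levels := ?_
              respects := ?_ }, fun p hp =>
      ⟨Finset.subset_biUnion_of_mem (fun p : Medini A B Apart Bpart => p.graph) hp,
        (hperm (hcode p hp)).1⟩⟩ <;> intro z hz <;>
      obtain ⟨p, hp, hz⟩ := Finset.mem_biUnion.1 hz
    · exact p.maps z hz
    · intro w hw
      obtain ⟨q, hq, hw⟩ := Finset.mem_biUnion.1 hw
      exact (hgraph _ p (hF p hp) q (hF q hq) z hz w hw).1
    · intro w hw
      obtain ⟨q, hq, hw⟩ := Finset.mem_biUnion.1 hw
      exact (hgraph _ p (hF p hp) q (hF q hq) z hz w hw).2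
    · exact p.levels z hz
    · exact (hperm (hcode p hp)).2 _ _ (p.respects z hz)

end Medini

/-! ### Finite subfamilies of a tower -/

theorem AlmostSubset.trans {X Y Z : Set ℕ} (h : AlmostSubset X Y) (h' : AlmostSubset Y Z) :
    AlmostSubset X Z :=
  (Set.Finite.union h h').subset fun n hn => by
    by_cases hY : n ∈ Y
    · exact .inr ⟨hY, hn.2⟩
    · exact .inl ⟨hn.1, hY⟩

theorem IsTower.exists_almostSubset {T : Set (Set ℕ)} (hT : IsTower T) (hne : T.Nonempty)
    {F : Set (Set ℕ)} (hF : F.Finite) (hFT : F ⊆ T) :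
    ∃ Y ∈ T, ∀ Z ∈ F, AlmostSubset Y Z := by
  induction F, hF using Set.Finite.induction_on with
  | empty => exact ⟨hne.some, hne.some_mem, by simp⟩
  | @insert Z F _ _ ih =>
    obtain ⟨hZ, hFT⟩ := Set.insert_subset_iff.1 hFT
    obtain ⟨Y, hY, h⟩ := ih hFT
    -- Well ordering of a pair makes its members comparable; `W` is the larger one, and the other
    -- serves as the new lower bound.
    obtain ⟨W, hW, hmax⟩ := hT.wellOrdered {Y, Z} (by simp [Set.insert_subset_iff, hY, hZ])
      (by simp)
    rcases hW with rfl | rfl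
    · have hZW : AlmostSubset Z W := hmax Z (by simp)
      refine ⟨Z, hZ, fun V hV => ?_⟩
      rcases hV with rfl | hV
      · simp [AlmostSubset]
      · exact hZW.trans (h V hV)
    · refine ⟨Y, hY, fun V hV => ?_⟩
      rcases hV with rfl | hV
      · exact hmax Y (by simp)
      · exact h V hV

theorem IsTower.infinite_iInter {T : Set (Set ℕ)} (hT : IsTower T) (hne : T.Nonempty)
    {F : Set (Set ℕ)} (hF : F.Finite) (hFT : F ⊆ T) : (⋂₀ F).Infinite := by
  obtain ⟨Y, hY, h⟩ := hT.exists_almostSubset hne hF hFT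
  refine ((hT.infinite Y hY).sdiff (hF.biUnion h)).mono fun n hn Z hZ => ?_
  by_contra hnZ
  exact hn.2 (Set.mem_biUnion hZ ⟨hn.1, hnZ⟩)

/-! ### Construction of a name of the generic map -/

namespace Forcing

variable {I : Type} {A B : Set Cantor} {Apart Bpart : I → Set Cantor}

theorem isReal.ext_of_dense {P : Type} [Preorder P] [OrderTop P] {x y : PName P} {p : P}
    (hx : isReal x p) (hy : isReal y p)
    (h : ∀ n, ∀ q ≤ p, ∃ r ≤ q, ∃ m > n, ∃ s, restrIs m x s r ∧ restrIs m y s r) :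
    eq x y p := by
  refine hx.ext hy fun n => of_dense fun q hq => ?_
  obtain ⟨r, hr, m, hm, s, hs, hs'⟩ := h n q hq
  exact ⟨r, hr, agree_of_restrIs hs hs' ⟨n, hm⟩⟩

theorem mem_pointsName_of_mem {P : Type} [Preorder P] [OrderTop P] {S : Set Cantor} {a : Cantor}
    (ha : a ∈ S) (p : P) : mem (subsetName (supp a)) (pointsName S) p :=
  mem_familyName_of_mem (Set.mem_image_of_mem supp ha) p

section ImageName

variable (G : ∀ p : Medini A B Apart Bpart, (Fin p.len → Bool) → Fin p.len → Bool)

/-- The name of the image of `x` under the map of `2^ω` approximated by the maps `G p` of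
`2^(n_p)` for `p` in the generic filter. -/
def imageName (x : PName (Medini A B Apart Bpart)) : PName (Medini A B Apart Bpart) :=
  niceName fun n => {r | ∃ c, r ≤ c ∧ ∃ hn : n < c.len, ∃ s,
    restrIs c.len x s r ∧ G c s ⟨n, hn⟩ = true}

variable {G}

/-- The maps `G p` cohere along extensions, so different conditions cannot assign different bits to
the image. A general `G` covers both the permutations and their inverses. -/
theorem restrIs_imageName
    (hG : ∀ (p q : Medini A B Apart Bpart) (h : q ≤ p) (t),
      restrFin h.2.1 (G q t) = G p (restrFin h.2.1 t))
    {x : PName (Medini A B Apart Bpart)} {c r : Medini A B Apart Bpart} (hr : r ≤ c)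
    {s : Fin c.len → Bool} (hs : restrIs c.len x s r) :
    restrIs c.len (imageName G x) (G c s) r := by
  refine fun i => ⟨fun q hq h => ?_, fun q hq h => ?_⟩
  · obtain ⟨r₁, hr₁, d, ⟨c', hdc, hn, s', hs', e⟩, hd⟩ := bit_niceName_iff.1 h q le_rfl
    obtain ⟨r₂, hr₂, t, ht⟩ := exists_restrIs r₁.len x r₁
    have hc : r₁ ≤ c := hr₁.trans (hq.trans hr)
    have hc' : r₁ ≤ c' := hd.trans hdc
    -- Both `s` and `s'` are restrictions of the longer sequence `t`, so coherence applied to `t`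
    -- compares the two bits.
    have e₁ := restrIs_unique (mono (hr₂.trans (hr₁.trans hq)) hs) (restrIs_restrFin hc.2.1 ht)
    have e₂ := restrIs_unique (mono (hr₂.trans hd) hs') (restrIs_restrFin hc'.2.1 ht)
    have g₁ := congrFun (hG c r₁ hc t) i
    have g₂ := congrFun (hG c' r₁ hc' t) ⟨i, hn⟩
    rw [← e₁] at g₁
    rw [← e₂, e] at g₂
    exact g₁.symm.trans g₂
  · exact bit_niceName_iff.2 fun q' hq' => ⟨q', le_rfl, q',
      ⟨c, hq'.trans (hq.trans hr), i.2, s, mono (hq'.trans hq) hs, h⟩, le_rfl⟩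

end ImageName

/-- A name of the generic map: the set of all pairs `(x, y)` of names of reals where `y` is the
image of `x` under the permutations in the generic filter. -/
def genericMapName : PName (Medini A B Apart Bpart) :=
  ⟨ℕ → Set (Medini A B Apart Bpart), fun f => opair (niceName f)
    (imageName (fun p => p.perm) (niceName f)), fun _ => ⊤⟩

theorem mem_genericMapName_iff {z : PName (Medini A B Apart Bpart)}
    {p : Medini A B Apart Bpart} : mem z genericMapName p ↔ ∀ q ≤ p, ∃ r ≤ q,
      ∃ f : ℕ → Set (Medini A B Apart Bpart),
        eq z (opair (niceName f) (imageName (fun p => p.perm) (niceName f))) r := by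
  constructor
  · intro h q hq
    obtain ⟨r, hr, f, -, e⟩ := h q hq
    exact ⟨r, hr, f, e⟩
  · intro h q hq
    obtain ⟨r, hr, f, e⟩ := h q hq
    exact ⟨r, hr, f, le_top, e⟩

theorem restrIs_imageName_perm {x : PName (Medini A B Apart Bpart)}
    {c r : Medini A B Apart Bpart} (hr : r ≤ c)
    {s : Fin c.len → Bool} (hs : restrIs c.len x s r) :
    restrIs c.len (imageName (fun p => p.perm) x) (c.perm s) r :=
  restrIs_imageName (G := fun p => p.perm) (fun _ _ h t => h.2.2 t) hr hs

/-- The image depends only on the real and not on its name; this yields the single-valuedness of the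
generic map. -/
theorem imageName_perm_congr {x x' : PName (Medini A B Apart Bpart)}
    {p : Medini A B Apart Bpart} (e : eq x x' p) :
    eq (imageName (fun p => p.perm) x) (imageName (fun p => p.perm) x') p := by
  refine (isReal_niceName _ _).ext_of_dense (isReal_niceName _ _) fun n q hq => ?_
  obtain ⟨q₁, hq₁, hn⟩ := q.exists_le_len (n + 1)
  obtain ⟨r, hr, s, hs⟩ := exists_restrIs q₁.len x q₁
  exact ⟨r, hr.trans hq₁, q₁.len, hn, q₁.perm s, restrIs_imageName_perm hr hs,
    restrIs_imageName_perm hr (restrIs_congr (mono (hr.trans (hq₁.trans hq)) e) hs)⟩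

theorem isGenericMap_genericMapName :
    IsGenericMap (genericMapName : PName (Medini A B Apart Bpart)) := by
  refine fun p => ⟨⟨fun z q _ h q' hq' => ?_, fun x q _ hx => ?_,
    fun x y y' q _ h => of_dense fun q' hq' => ?_⟩,
    fun c q hq hc x y q₁ hq₁ h s q₂ hq₂ hs => of_dense fun q₃ hq₃ => ?_⟩
  · obtain ⟨r, hr, f, e⟩ := mem_genericMapName_iff.1 h q' hq'
    exact ⟨r, hr, niceName f, fun r' hr' => ⟨r', le_rfl, imageName (fun p => p.perm) (niceName f),
      ⟨isReal_niceName _ _, isReal_niceName _ _⟩, mono hr' e⟩⟩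
  · refine ex_intro (imageName (fun p => p.perm) x) (mem_genericMapName_iff.2 fun q' hq' => ?_)
    have e := mono hq' hx.eq_niceName
    exact ⟨q', le_rfl, _, opair_congr e (imageName_perm_congr e)⟩
  · obtain ⟨r, hr, f, e⟩ := mem_genericMapName_iff.1 h.1 q' hq'
    obtain ⟨r', hr', f', e'⟩ := mem_genericMapName_iff.1 h.2 r (hr.trans hq')
    have e := mono hr' e
    refine ⟨r', hr'.trans hr, eq_trans (eq_trans (snd_eq_of_opair_eq e) (imageName_perm_congr ?_))
      (eq_symm (snd_eq_of_opair_eq e'))⟩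
    exact eq_trans (eq_symm (fst_eq_of_opair_eq e)) (fst_eq_of_opair_eq e')
  · obtain ⟨r, hr, hrc⟩ := hc q₃ (hq₃.trans (hq₂.trans hq₁))
    obtain ⟨r', hr', f, e⟩ := mem_genericMapName_iff.1 h r (hr.trans (hq₃.trans hq₂))
    refine ⟨r', hr'.trans hr, restrIs_congr (eq_symm (snd_eq_of_opair_eq e))
      (restrIs_imageName_perm (hr'.trans hrc) (restrIs_congr (fst_eq_of_opair_eq e) ?_))⟩
    exact mono (hr'.trans (hr.trans hq₃)) hs

/-! ### Properties shared by all names of the generic map -/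

namespace IsGenericMap

variable {h : PName (Medini A B Apart Bpart)} (hh : IsGenericMap h)
  {p q : Medini A B Apart Bpart} {x y x' y' : PName (Medini A B Apart Bpart)}
include hh

theorem isReal_of_app (ha : app h x y p) : isReal x p ∧ isReal y p := by
  have key : ∀ q ≤ p, ∃ r ≤ q, isReal x r ∧ isReal y r := by
    intro q hq
    obtain ⟨r, hr, x', hx'⟩ := (hh p).1.1 _ p le_rfl ha q hq
    obtain ⟨r', hr', y', ⟨hx, hy⟩, e⟩ := hx' r le_rfl
    exact ⟨r', hr'.trans hr, isReal_congr hx (eq_symm (fst_eq_of_opair_eq e)),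
      isReal_congr hy (eq_symm (snd_eq_of_opair_eq e))⟩
  exact ⟨of_dense fun q hq => let ⟨r, hr, e⟩ := key q hq; ⟨r, hr, e.1⟩,
    of_dense fun q hq => let ⟨r, hr, e⟩ := key q hq; ⟨r, hr, e.2⟩⟩

theorem exists_app (hx : isReal x p) : ∃ q ≤ p, ∃ y, app h x y q :=
  (hh p).1.2.1 x p le_rfl hx p le_rfl

theorem functional (ha : app h x y p) (ha' : app h x y' p) : eq y y' p :=
  (hh p).1.2.2 x y y' p le_rfl ⟨ha, ha'⟩

theorem restrIs_perm (hq : q ≤ p) (ha : app h x y q) {s : Fin p.len → Bool}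
    (hs : restrIs p.len x s q) : restrIs p.len y (p.perm s) q :=
  (hh q).2 p q le_rfl (inGeneric_of_le hq) x y q le_rfl ha s q le_rfl hs

theorem exists_restrIs_perm (ha : app h x y q) (hq : q ≤ p) :
    ∃ r ≤ q, ∃ s, restrIs p.len x s r ∧ restrIs p.len y (p.perm s) r := by
  obtain ⟨r, hr, s, hs⟩ := exists_restrIs p.len x q
  exact ⟨r, hr, s, hs, hh.restrIs_perm (hr.trans hq) (mono hr ha) hs⟩

theorem agree_image (hq : q ≤ p) (ha : app h x y q) (ha' : app h x' y' q)
    (e : agree p.len x x' q) : agree p.len y y' q := by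
  refine of_dense fun q₁ hq₁ => ?_
  obtain ⟨r, hr, s, hs, ht⟩ := hh.exists_restrIs_perm (mono hq₁ ha) (hq₁.trans hq)
  exact ⟨r, hr, agree_of_restrIs ht (hh.restrIs_perm (hr.trans (hq₁.trans hq))
    (mono (hr.trans hq₁) ha') (restrIs_of_agree (mono (hr.trans hq₁) e) hs))⟩

/-- The permutation of `p` is injective, so the first `p.len` bits of a value determine those of the
argument. This gives both injectivity of `h` and continuity of its inverse. -/
theorem agree_preimage (hq : q ≤ p) (ha : app h x y q) (ha' : app h x' y' q)
    (e : agree p.len y y' q) : agree p.len x x' q := by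
  refine of_dense fun q₁ hq₁ => ?_
  obtain ⟨r, hr, s, hs, ht⟩ := hh.exists_restrIs_perm (mono hq₁ ha) (hq₁.trans hq)
  obtain ⟨r', hr', s', hs', ht'⟩ := hh.exists_restrIs_perm
    (mono (hr.trans hq₁) ha') (hr.trans (hq₁.trans hq))
  have := restrIs_unique ht' (restrIs_of_agree (mono (hr'.trans (hr.trans hq₁)) e) (mono hr' ht))
  rw [p.perm.injective this] at hs'
  exact ⟨r', hr'.trans hr, agree_of_restrIs (mono hr' hs) hs'⟩

theorem injective (ha : app h x y p) (ha' : app h x' y p) : eq x x' p := by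
  refine (hh.isReal_of_app ha).1.ext_of_dense (hh.isReal_of_app ha').1 fun n q hq => ?_
  obtain ⟨q₁, hq₁, hn⟩ := q.exists_le_len (n + 1)
  obtain ⟨r, hr, s, hs⟩ := exists_restrIs q₁.len x q₁
  refine ⟨r, hr.trans hq₁, q₁.len, hn, s, hs, restrIs_of_agree ?_ hs⟩
  have hrp := hr.trans (hq₁.trans hq)
  exact hh.agree_preimage hr (mono hrp ha) (mono hrp ha')
    (fun _ => ⟨fun _ _ h => h, fun _ _ h => h⟩)

/-- The inverse permutations cohere as well, and the real they build from `y` is the preimage. -/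
theorem surjective (hy : isReal y p) : ∃ q ≤ p, ∃ x, isReal x q ∧ app h x y q := by
  let G : ∀ p : Medini A B Apart Bpart, (Fin p.len → Bool) → Fin p.len → Bool :=
    fun p => p.perm.symm
  have hx : ∀ p, isReal (imageName G y) p := fun p => isReal_niceName _ p
  obtain ⟨q, hq, y', ha⟩ := hh.exists_app (hx p)
  refine ⟨q, hq, imageName G y, hx q, app_congr ha (eq_refl _ _) ?_⟩
  refine (hh.isReal_of_app ha).2.ext_of_dense (mono hq hy) fun n q₁ hq₁ => ?_
  obtain ⟨q₂, hq₂, hn⟩ := q₁.exists_le_len (n + 1)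
  obtain ⟨r, hr, s, hs⟩ := exists_restrIs q₂.len y q₂
  refine ⟨r, hr.trans hq₂, q₂.len, hn, s, ?_, hs⟩
  have := hh.restrIs_perm hr (mono (hr.trans (hq₂.trans hq₁)) ha)
    (restrIs_imageName (G := G) (fun _ _ h t => Medini.restrFin_perm_symm h t) hr hs)
  simpa [G] using this

theorem forced_isHomeo : Forced (isHomeo h) := by
  refine fun p => ⟨(hh p).1, ⟨fun x x' y q _ ha => hh.injective ha.1 ha.2,
    fun y q _ hy q' hq' => ?_⟩, fun x y q _ ha m q' hq' => ?_, fun x y q _ ha m q' hq' => ?_⟩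
  · obtain ⟨r, hr, x, -, ha⟩ := hh.surjective (mono hq' hy)
    exact ⟨r, hr, x, ha⟩
  · obtain ⟨r, hr, hm⟩ := q'.exists_le_len m
    refine ⟨r, hr, r.len, fun x' y' r' hr' ha' i => ?_⟩
    exact hh.agree_image hr' (mono (hr'.trans (hr.trans hq')) ha) ha'.1 ha'.2 (Fin.castLE hm i)
  · obtain ⟨r, hr, hm⟩ := q'.exists_le_len m
    refine ⟨r, hr, r.len, fun x' y' r' hr' ha' i => ?_⟩
    exact hh.agree_preimage hr' (mono (hr'.trans (hr.trans hq')) ha) ha'.1 ha'.2 (Fin.castLE hm i)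

/-- Extensions of `p` keep `(a, b)` in their graph, and by `respects` their permutations, of
unbounded length, send restrictions of `a` to those of `b`. -/
theorem app_of_mem_graph {a b : Cantor} (hab : (a, b) ∈ p.graph) :
    app h (subsetName (supp a)) (subsetName (supp b)) p := by
  refine of_dense fun q hq => ?_
  obtain ⟨r, hr, y, ha⟩ := hh.exists_app (isReal_subsetName (supp a) q)
  refine ⟨r, hr, app_congr ha (eq_refl _ _) ?_⟩
  refine (hh.isReal_of_app ha).2.ext_of_dense (isReal_subsetName _ _) fun n q₁ hq₁ => ?_
  obtain ⟨q₂, hq₂, hn⟩ := q₁.exists_le_len (n + 1)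
  have hle := hq₂.trans hq₁
  refine ⟨q₂, hq₂, q₂.len, hn, q₂.perm (restr q₂.len a),
    hh.restrIs_perm le_rfl (mono hle ha) (restrIs_subsetName_supp _ _ _), ?_⟩
  rw [← q₂.respects (a, b) ((hle.trans (hr.trans hq)).1 hab)]
  exact restrIs_subsetName_supp _ _ _

theorem forced_extendsGeneric : Forced (extendsGeneric h) := by
  intro p c q _ hc z
  refine of_dense fun q' hq' => ?_
  obtain ⟨r, hr, hrc⟩ := hc q' hq'
  exact ⟨r, hr, hh.app_of_mem_graph (hrc.1 z.2)⟩

/-- By density every ground model point of `A` or `B` gets into the domain or the range of a finite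
map in the generic filter, and `h` extends that map. -/
theorem forced_imageEq (hApart : IsCountableDensePartition A Apart)
    (hBpart : IsCountableDensePartition B Bpart) :
    Forced (imageEq h (pointsName A) (pointsName B)) := by
  refine fun p y => ⟨fun q _ hy q' hq' => ?_, fun q _ hx => of_dense fun q' hq' => ?_⟩
  · obtain ⟨r, hr, ⟨_, b, hb, rfl⟩, e⟩ := mem_familyName_iff.1 hy q' hq'
    obtain ⟨r', hr', a, hab⟩ := Medini.exists_le_mem_range hApart hBpart r hb
    refine ⟨r', hr'.trans hr, subsetName (supp a), mem_pointsName_of_mem (r'.maps _ hab).1 _,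
      app_congr (hh.app_of_mem_graph hab) (eq_refl _ _) (eq_symm (mono hr' e))⟩
  · obtain ⟨r, hr, x, hxA, ha⟩ := hx q' hq'
    obtain ⟨r₁, hr₁, ⟨_, a, haA, rfl⟩, e⟩ := mem_familyName_iff.1 hxA r le_rfl
    obtain ⟨r₂, hr₂, b, hab⟩ := Medini.exists_le_mem_domain hApart hBpart r₁ haA
    refine ⟨r₂, hr₂.trans (hr₁.trans hr), mem_congr_left (mem_pointsName_of_mem (r₂.maps _ hab).2 _)
      (hh.functional (hh.app_of_mem_graph hab) ?_)⟩
    exact app_congr (mono (hr₂.trans hr₁) ha) (mono hr₂ e) (eq_refl _ _)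

theorem bit_iff {n : ℕ} (hn : p.FixesCoord n) (ha : app h x y p) :
    iff (bit n x) (bit n y) p := by
  refine of_dense fun q hq => ?_
  obtain ⟨hn, hp⟩ := hn
  obtain ⟨r, hr, s, hs, ht⟩ := hh.exists_restrIs_perm (mono hq ha) hq
  have ht : iff (bit n y) (ground (p.perm s ⟨n, hn⟩ = true)) r := ht ⟨n, hn⟩
  rw [hp] at ht
  have hs : iff (bit n x) (ground (s ⟨n, hn⟩ = true)) r := hs ⟨n, hn⟩
  exact ⟨r, hr, fun r' hr' e => ht.2 r' hr' (hs.1 r' hr' e),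
    fun r' hr' e => hs.2 r' hr' (ht.1 r' hr' e)⟩

theorem fixesBit_of_fixesCoord {n : ℕ} (hn : p.FixesCoord n) : fixesBit h n p := by
  refine fun y => ⟨fun q hq hy q' hq' => ?_, fun q hq hx => of_dense fun q' hq' => ?_⟩
  · obtain ⟨r, hr, x, hx, ha⟩ := hh.surjective (mono hq' hy.1)
    refine ⟨r, hr, x, ⟨hx, ?_⟩, ha⟩
    exact (hh.bit_iff (hn.mono (hr.trans (hq'.trans hq))) ha).2 r le_rfl
      (mono (hr.trans hq') hy.2)
  · obtain ⟨r, hr, x, ⟨_, hx⟩, ha⟩ := hx q' hq'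
    exact ⟨r, hr, (hh.isReal_of_app ha).2,
      (hh.bit_iff (hn.mono (hr.trans (hq'.trans hq))) ha).1 r le_rfl hx⟩

end IsGenericMap

end Forcing

/-! ### Fixed coordinates in the top element and the pseudointersection -/

section Tower

variable {T : Set (Set ℕ)} {X : Set ℕ} {I : Type} {A B : Set Cantor} {Apart Bpart : I → Set Cantor}

/-- Every condition can be extended to fix an arbitrarily large coordinate in the top element. -/
theorem Medini.exists_le_fixesCoord_mem (hT : IsTower T) (hX : X ∈ T)
    (hA : A = {a | ∃ Y ∈ T, a = charFn Yᶜ}) (hB : ∀ b ∈ B, (supp b ∩ X).Finite)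
    (p : Medini A B Apart Bpart) (k : ℕ) : ∃ q ≤ p, ∃ n ≥ k, n ∈ X ∧ q.FixesCoord n := by
  have hY : ∀ z ∈ p.graph, ∃ Y ∈ T, z.1 = charFn Yᶜ := fun z hz => by
    have := (p.maps z hz).1
    rwa [hA] at this
  let F : Set (Set ℕ) := insert X ((fun z : Cantor × Cantor => (supp z.1)ᶜ) '' p.graph)
  have hmem : ∀ z ∈ p.graph, (supp z.1)ᶜ ∈ T := fun z hz => by
    obtain ⟨Y, hY, e⟩ := hY z hz
    have : (supp z.1)ᶜ = Y := by
      rw [e]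
      ext n
      simp [supp, charFn]
    rwa [this]
  have hF : (⋂₀ F).Infinite := hT.infinite_iInter ⟨X, hX⟩
    ((p.graph.finite_toSet.image _).insert X) (by
      rintro Y (rfl | ⟨z, hz, rfl⟩)
      · exact hX
      · exact hmem z hz)
  have hfin : (⋃ z ∈ p.graph, supp z.2 ∩ X).Finite :=
    p.graph.finite_toSet.biUnion fun z hz => hB _ (p.maps z hz).2
  have hS := (hF.sdiff hfin).sdiff (Set.finite_lt_nat k)
  -- At places in all these tower members, outside the finite traces of the range points on `X`,
  -- both coordinates of every pair in the graph are `0`.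
  obtain ⟨q, hq, n, ⟨⟨hnF, hnB⟩, hnk⟩, hn⟩ := p.exists_le_fixesCoord hS (by
    rintro n ⟨⟨hnF, hnB⟩, -⟩ z hz
    have h1 : n ∉ supp z.1 := hnF _ (.inr ⟨z, hz, rfl⟩)
    have h2 : n ∉ supp z.2 := fun h =>
      hnB (Set.mem_biUnion hz ⟨h, hnF _ (.inl rfl)⟩)
    rw [Bool.eq_iff_iff]
    exact ⟨fun h => (h2 h).elim, fun h => (h1 h).elim⟩)
  exact ⟨q, hq, n, not_lt.1 hnk, hnF _ (.inl rfl), hn⟩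

open Forcing

/-- The witness is the set of `n ∈ X` fixed by some condition in the generic filter. To see that it
is almost contained in `Z'`, the complement of `Z'` is put into the domain with image `b`, and a
bound of `supp b ∩ X` bounds the exceptions. -/
theorem Forcing.forced_exists_pseudointersection (hT : IsTower T) (hX : X ∈ T)
    (hA : A = {a | ∃ Y ∈ T, a = charFn Yᶜ}) (hB : ∀ b ∈ B, (supp b ∩ X).Finite)
    (hApart : IsCountableDensePartition A Apart) (hBpart : IsCountableDensePartition B Bpart) :
    Forced (ex fun Y : PName (Medini A B Apart Bpart) =>
      isPseudointersection Y (familyName T)) := by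
  let f (n : ℕ) : Set (Medini A B Apart Bpart) := {p | n ∈ X ∧ p.FixesCoord n}
  refine fun p q _ => ⟨q, le_rfl, niceName f, ⟨isReal_niceName _ _, fun k q _ => ?_⟩,
    fun Z q _ hZ q₁ hq₁ => ?_⟩
  · obtain ⟨r, hr, n, hk, hn⟩ := q.exists_le_fixesCoord_mem hT hX hA hB k
    exact ⟨r, hr, n, ⟨hk, bit_niceName_iff.2 fun r' hr' => ⟨r', le_rfl, r, hn, hr'⟩⟩, trivial⟩
  · obtain ⟨r, hr, ⟨Z', hZ'⟩, e⟩ := mem_familyName_iff.1 hZ q₁ hq₁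
    obtain ⟨r₁, hr₁, b, hab⟩ := Medini.exists_le_mem_domain hApart hBpart r
      (a := charFn Z'ᶜ) (by rw [hA]; exact ⟨Z', hZ', rfl⟩)
    obtain ⟨k, hk⟩ := (hB b (r₁.maps _ hab).2).bddAbove
    refine ⟨r₁, hr₁.trans hr, k + 1, fun n r₂ hr₂ h => ?_⟩
    refine bit_congr ?_ (eq_symm (mono (hr₂.trans hr₁) e))
    rw [bit_subsetName_iff]
    obtain ⟨r₃, hr₃, c, ⟨hnX, hc⟩, hr₃c⟩ := bit_niceName_iff.1 h.2 r₂ le_rfl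
    have hval := (hc.mono hr₃c).apply_eq ((hr₃.trans hr₂).1 hab)
    have hkn : k + 1 ≤ n := h.1
    by_contra hn
    -- Outside `Z'` its complement has bit `1`, and fixing coordinate `n` transfers this bit to `b`.
    have : n ∈ supp b := hval.trans (by simp [charFn, hn])
    exact absurd (hk ⟨this, hnX⟩) (by omega)

end Tower

theorem theorem3p2
    (T : Set (Set ℕ)) (hT : IsTower T) (hTcard : #T = ℵ₁)
    (hTdense : AlephOneDense (charFn '' T))
    (X : Set ℕ) (hX : X ∈ T) (hXtop : ∀ Y ∈ T, AlmostSubset Y X) (hXco : Xᶜ.Infinite)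
    (A : Set Cantor) (hA : A = {a | ∃ Y ∈ T, a = charFn Yᶜ})
    (B : Set Cantor) (hB : AlephOneDense B)
    (hBX : ∀ b ∈ B, (supp b).Infinite ∧ (supp b ∩ X).Finite)
    (I : Type) (hI : #I = ℵ₁) (Apart Bpart : I → Set Cantor)
    (hApart : IsCountableDensePartition A Apart) (hBpart : IsCountableDensePartition B Bpart) :
    SigmaCentered (Medini A B Apart Bpart) ∧
    (∃ h : PName (Medini A B Apart Bpart), Forcing.IsGenericMap h) ∧
    (∀ h : PName (Medini A B Apart Bpart), Forcing.IsGenericMap h →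
      Forcing.Forced (Forcing.isHomeo h) ∧
      Forcing.Forced (Forcing.extendsGeneric h) ∧
      Forcing.Forced (Forcing.imageEq h (Forcing.pointsName A) (Forcing.pointsName B)) ∧
      Forcing.Forced (Forcing.infinitelyMany (Forcing.subsetName X)
        fun n => Forcing.fixesBit h n)) ∧
    Forcing.Forced (Forcing.ex fun Y : PName (Medini A B Apart Bpart) =>
      Forcing.isPseudointersection Y (Forcing.familyName T)) := by
  have hBfin : ∀ b ∈ B, (supp b ∩ X).Finite := fun b hb => (hBX b hb).2
  refine ⟨Medini.sigmaCentered (hI.trans_le Cardinal.aleph_one_le_continuum) hApart hBpart,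
    ⟨_, Forcing.isGenericMap_genericMapName⟩, fun h hh => ⟨hh.forced_isHomeo,
      hh.forced_extendsGeneric, hh.forced_imageEq hApart hBpart, fun p k q _ => ?_⟩,
    Forcing.forced_exists_pseudointersection hT hX hA hBfin hApart hBpart⟩
  obtain ⟨r, hr, n, hk, hnX, hn⟩ := q.exists_le_fixesCoord_mem hT hX hA hBfin k
  exact ⟨r, hr, n, ⟨hk, Forcing.bit_subsetName_iff.2 hnX⟩, hh.fixesBit_of_fixesCoord hn⟩
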